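/- Let $\mathbb{E}$ be the Engel group, i.e. the Carnot group whose Lie algebra is $V_1\oplus V_2\oplus V_3$ with $V_1=\mathrm{span}\{X_1,X_2\}$, $V_2=\mathrm{span}\{X_3\}$, $V_3=\mathrm{span}\{X_4\}$, and whose only non-zero brackets among basis vectors are (up to antisymmetry) $[X_1,X_2]=X_3$ and $[X_1,X_3]=X_4$. Equip $V_1$ with the norm $\|\cdot\|$ for which $X_1,X_2$ are orthonormal, and let $d$ be the Carnot–Carathéodory distance on $\mathbb{E}$, i.e. $d(x,y)$ is the infimum of the lengths $\int_s^t\|\gamma'\|$ of absolutely continuous horizontal curves $\gamma\colon[s,t]\to\mathbb{E}$ joining $x$ to $y$. Let $C^1_H([0,1],\mathbb{E})$ be the set of curves $\gamma\colon[0,1]\to\mathbb{E}$ whose derivative $\gamma'$ (identified with an element of the Lie algebra by left translation) exists, is continuous and takes values in $V_1$, with the metric $$\max\Big(\sup_{t\in[0,1]} d(\gamma_1(t),\gamma_2(t)),\ \sup_{t\in[0,1]}\|\gamma_2'(t)-\gamma_1'(t)\|\Big).$$ A vector $V\in V_1$ is called pliable if, writing $L(t)=\exp(tV)$ for $t\in[0,1]$,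 for every neighborhood $\mathcal{V}$ of $L$ in $C^1_H([0,1],\mathbb{E})$ the set $$\{(\beta(1),\beta'(1)) : \beta\in\mathcal{V},\ (\beta(0),\beta'(0))=(L(0),L'(0))\}$$ is a neighborhood of $(L(1),L'(1))$ in $\mathbb{E}\times V_1$. **Theorem.** For all $a,b\in\mathbb{R}$, the vector $V=aX_1+bX_2\in V_1$ is pliable if and only if either $a\neq 0$ or $a=b=0$. Consequently, the non-pliable vectors of $V_1$ are exactly the vectors $cX_2$ with $c\in\mathbb{R}\setminus\{0\}$. -/

import Mathlib

open Set Filter Topology MeasureTheory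
open scoped ENNReal

noncomputable section

namespace Engel

/-- The manifold underlying the Engel group: `ℝ⁴`, a point `(x₁, x₂, x₃, x₄)` standing for
`exp (x₄ X₄) exp (x₃ X₃) exp (x₂ X₂) exp (x₁ X₁)` (exponential coordinates of the second kind).
Coordinates are indexed from `0` in the code. The norm, the topology and the derivatives are the
Euclidean ones; the sub-Riemannian distance is `ccDist` below. -/
abbrev Point : Type := EuclideanSpace ℝ (Fin 4)

/-- The Lie algebra, as the tangent space at the identity, in the basis `X₁, X₂, X₃, X₄`
(the standard basis, which is declared to be orthonormal). -/
abbrev Alg : Type := EuclideanSpace ℝ (Fin 4)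

instance instMulPoint : Mul Point :=
  ⟨fun x y => !₂[x 0 + y 0, x 1 + y 1, x 2 + y 2 + x 0 * y 1,
    x 3 + y 3 + x 0 * y 2 + x 0 ^ 2 / 2 * y 1]⟩

instance instOnePoint : One Point := ⟨0⟩

instance instInvPoint : Inv Point :=
  ⟨fun x => !₂[-x 0, -x 1, x 0 * x 1 - x 2, x 0 * x 2 - x 0 ^ 2 / 2 * x 1 - x 3]⟩

theorem mul_def (x y : Point) : x * y = !₂[x 0 + y 0, x 1 + y 1, x 2 + y 2 + x 0 * y 1,
    x 3 + y 3 + x 0 * y 2 + x 0 ^ 2 / 2 * y 1] := rfl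

theorem inv_def (x : Point) :
    x⁻¹ = !₂[-x 0, -x 1, x 0 * x 1 - x 2, x 0 * x 2 - x 0 ^ 2 / 2 * x 1 - x 3] := rfl

theorem one_def : (1 : Point) = 0 := rfl

/-- The Engel group. -/
instance instGroupPoint : Group Point :=
  Group.ofLeftAxioms
    (by
      intro x y z
      ext i
      fin_cases i <;> simp [mul_def] <;> ring)
    (by
      intro x
      ext i
      fin_cases i <;> simp [mul_def, one_def])
    (by
      intro x
      ext i
      fin_cases i <;> simp [mul_def, inv_def, one_def] <;> ring)

/-- The left-invariant vector field whose value at the identity is `v`. -/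
def leftField (v : Alg) (x : Point) : Alg := fderiv ℝ (fun y : Point => x * y) 1 v

/-- The basis vectors of the Lie algebra: `basisVec 0 = X₁`, …, `basisVec 3 = X₄`. -/
def basisVec (i : Fin 4) : Alg := EuclideanSpace.single i (1 : ℝ)

/-- The horizontal layer `V₁ = span {X₁, X₂}`, with the norm for which `X₁, X₂` are
orthonormal. -/
def horizontalLayer : Submodule ℝ Alg := Submodule.span ℝ {basisVec 0, basisVec 1}

/-- `X₁` as an element of the horizontal layer. -/
def X₁ : horizontalLayer := ⟨basisVec 0, Submodule.subset_span (by simp)⟩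

/-- `X₂` as an element of the horizontal layer. -/
def X₂ : horizontalLayer := ⟨basisVec 1, Submodule.subset_span (by simp)⟩

/-- The exponential map in these coordinates; `exp_add_smul` and `hasDerivAt_exp_smul` show that
`t ↦ exp (t v)` is the one-parameter subgroup with tangent vector `v` at the identity. -/
def exp (v : Alg) : Point :=
  !₂[v 0, v 1, v 2 + v 0 * v 1 / 2, v 3 + v 0 * v 2 / 2 + v 0 ^ 2 * v 1 / 6]

theorem exp_add_smul (v : Alg) (s t : ℝ) : exp ((s + t) • v) = exp (s • v) * exp (t • v) := by
  ext i
  fin_cases i <;> simp [mul_def, exp] <;> ring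

theorem exp_zero : exp 0 = 1 := by
  ext i
  fin_cases i <;> simp [one_def, exp]

/-- The coordinates are exponential coordinates of the second kind. -/
theorem eq_exp_mul_exp_mul_exp_mul_exp (x : Point) :
    x = exp (x 3 • basisVec 3) * exp (x 2 • basisVec 2) * exp (x 1 • basisVec 1) *
      exp (x 0 • basisVec 0) := by
  ext i
  fin_cases i <;> simp [mul_def, exp, basisVec]

theorem hasDerivAt_toLp {f₀ f₁ f₂ f₃ : ℝ → ℝ} {a₀ a₁ a₂ a₃ t : ℝ} (h₀ : HasDerivAt f₀ a₀ t)
    (h₁ : HasDerivAt f₁ a₁ t) (h₂ : HasDerivAt f₂ a₂ t) (h₃ : HasDerivAt f₃ a₃ t) :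
    HasDerivAt (fun s => (!₂[f₀ s, f₁ s, f₂ s, f₃ s] : EuclideanSpace ℝ (Fin 4)))
      !₂[a₀, a₁, a₂, a₃] t := by
  have h : HasDerivAt (fun s => ![f₀ s, f₁ s, f₂ s, f₃ s]) ![a₀, a₁, a₂, a₃] t := by
    rw [hasDerivAt_pi]
    intro i
    fin_cases i <;> simpa
  exact (PiLp.continuousLinearEquiv 2 ℝ (fun _ : Fin 4 => ℝ)).symm.hasFDerivAt.comp_hasDerivAt t h

theorem contDiff_mul {n : WithTop ℕ∞} : ContDiff ℝ n (fun p : Point × Point => p.1 * p.2) := by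
  rw [contDiff_euclidean]
  intro i
  fin_cases i <;> simp [mul_def] <;> fun_prop

theorem contDiff_inv {n : WithTop ℕ∞} : ContDiff ℝ n (fun p : Point => p⁻¹) := by
  rw [contDiff_euclidean]
  intro i
  fin_cases i <;> simp [inv_def] <;> fun_prop

theorem leftField_eq (v : Alg) (x : Point) :
    leftField v x = !₂[v 0, v 1, v 2 + x 0 * v 1, v 3 + x 0 * v 2 + x 0 ^ 2 / 2 * v 1] := by
  have hd : DifferentiableAt ℝ (fun y : Point => x * y) 1 := by
    have : ContDiff ℝ 1 (fun y : Point => x * y) :=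
      contDiff_mul.comp (contDiff_const.prodMk contDiff_id)
    exact (this.differentiable (by simp)) 1
  have hl : HasDerivAt (fun t : ℝ => t • v) v 0 := by
    simpa using (hasDerivAt_id (0 : ℝ)).smul_const v
  have hc : HasDerivAt (fun t : ℝ => x * (t • v)) (leftField v x) 0 := by
    have h1 : HasFDerivAt (fun y : Point => x * y) (fderiv ℝ (fun y : Point => x * y) 1)
        ((0 : ℝ) • v) := by
      rw [zero_smul, ← one_def]
      exact hd.hasFDerivAt
    exact h1.comp_hasDerivAt (0 : ℝ) hl
  refine hc.unique ?_
  have hlin : ∀ c d : ℝ, HasDerivAt (fun t : ℝ => c + t * d) d 0 := by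
    intro c d
    simpa using ((hasDerivAt_id (0 : ℝ)).mul_const d).const_add c
  have key := hasDerivAt_toLp (hlin (x 0) (v 0)) (hlin (x 1) (v 1))
    (hlin (x 2) (v 2 + x 0 * v 1)) (hlin (x 3) (v 3 + x 0 * v 2 + x 0 ^ 2 / 2 * v 1))
  refine key.congr_of_eventuallyEq (Eventually.of_forall fun t => ?_)
  ext i
  fin_cases i <;> simp [mul_def] <;> ring

theorem hasDerivAt_exp_smul (v : Alg) (t : ℝ) :
    HasDerivAt (fun s : ℝ => exp (s • v)) (leftField v (exp (t • v))) t := by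
  have hp : ∀ c d e : ℝ, HasDerivAt (fun s : ℝ => c * s + d * s ^ 2 + e * s ^ 3)
      (c + d * (2 * t) + e * (3 * t ^ 2)) t := by
    intro c d e
    exact ((((hasDerivAt_id t).const_mul c).add ((hasDerivAt_pow 2 t).const_mul d)).add
      ((hasDerivAt_pow 3 t).const_mul e)).congr_deriv (by simp)
  have key := hasDerivAt_toLp (hp (v 0) 0 0) (hp (v 1) 0 0) (hp (v 2) (v 0 * v 1 / 2) 0)
    (hp (v 3) (v 0 * v 2 / 2) (v 0 ^ 2 * v 1 / 6))
  convert key using 1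
  · funext s
    ext i
    fin_cases i <;> simp [exp] <;> ring
  · rw [leftField_eq]
    ext i
    fin_cases i <;> simp [exp] <;> ring

theorem fderiv_leftField (v w : Alg) (x : Point) :
    fderiv ℝ (leftField v) x w = !₂[0, 0, w 0 * v 1, w 0 * v 2 + x 0 * w 0 * v 1] := by
  have hd : DifferentiableAt ℝ (leftField v) x := by
    have : leftField v = fun x => !₂[v 0, v 1, v 2 + x 0 * v 1,
        v 3 + x 0 * v 2 + x 0 ^ 2 / 2 * v 1] := funext (leftField_eq v)
    rw [this, differentiableAt_euclidean]
    intro i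
    fin_cases i <;> simp <;> fun_prop
  have hl : HasDerivAt (fun t : ℝ => x + t • w) w 0 := by
    simpa using ((hasDerivAt_id (0 : ℝ)).smul_const w).const_add x
  have hc : HasDerivAt (fun t : ℝ => leftField v (x + t • w)) (fderiv ℝ (leftField v) x w) 0 := by
    have h1 : HasFDerivAt (leftField v) (fderiv ℝ (leftField v) x) (x + (0 : ℝ) • w) := by
      rw [zero_smul, add_zero]
      exact hd.hasFDerivAt
    exact h1.comp_hasDerivAt (0 : ℝ) hl
  refine hc.unique ?_
  have hp : ∀ c d e : ℝ, HasDerivAt (fun s : ℝ => c + d * s + e * s ^ 2) d 0 := by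
    intro c d e
    exact ((((hasDerivAt_id (0 : ℝ)).const_mul d).const_add c).add
      ((hasDerivAt_pow 2 (0 : ℝ)).const_mul e)).congr_deriv (by simp)
  have key := hasDerivAt_toLp (hp (v 0) 0 0) (hp (v 1) 0 0) (hp (v 2 + x 0 * v 1) (w 0 * v 1) 0)
    (hp (v 3 + x 0 * v 2 + x 0 ^ 2 / 2 * v 1) (w 0 * v 2 + x 0 * w 0 * v 1)
      (w 0 ^ 2 / 2 * v 1))
  refine key.congr_of_eventuallyEq (Eventually.of_forall fun t => ?_)
  dsimp only
  rw [leftField_eq]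
  ext i
  fin_cases i <;> simp <;> ring

/-- The Lie bracket of left-invariant vector fields. On the basis it says
`[X₁, X₂] = X₃`, `[X₁, X₃] = X₄`, and that all other brackets vanish. -/
theorem lieBracket_leftField (v w : Alg) :
    VectorField.lieBracket ℝ (leftField v) (leftField w) =
      leftField ((v 0 * w 1 - w 0 * v 1) • basisVec 2 +
        (v 0 * w 2 - w 0 * v 2) • basisVec 3) := by
  funext x
  rw [VectorField.lieBracket, fderiv_leftField, fderiv_leftField, leftField_eq, leftField_eq,
    leftField_eq]
  ext i
  fin_cases i <;> simp [basisVec] <;> ring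

/-- `γ : [a, b] → 𝔼` is a horizontal curve with controls `u`, that is, `γ` is absolutely
continuous, `u ∈ L¹([a, b], V₁)`, and `γ̇ = u₁ X₁(γ) + u₂ X₂(γ)` almost everywhere. -/
structure IsHorizontalCurve (a b : ℝ) (γ : ℝ → Point) (u : ℝ → horizontalLayer) : Prop where
  le : a ≤ b
  absolutelyContinuous : AbsolutelyContinuousOnInterval γ a b
  integrable : IntegrableOn u (Icc a b)
  hasDerivAt : ∀ᵐ t ∂volume.restrict (Icc a b), HasDerivAt γ (leftField (u t) (γ t)) t

/-- The Carnot-Carathéodory distance: the infimum of the lengths `∫ |u|` of the horizontal curves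
joining `x` and `y`. It takes values in `[0, ∞]`, so that an infimum over the empty set would be
`∞` and suprema need no boundedness. -/
def ccDist (x y : Point) : ℝ≥0∞ :=
  sInf {L | ∃ (a b : ℝ) (γ : ℝ → Point) (u : ℝ → horizontalLayer),
    IsHorizontalCurve a b γ u ∧ γ a = x ∧ γ b = y ∧ L = ∫⁻ t in Icc a b, ‖u t‖ₑ}

/-- A `C¹` horizontal curve `γ : [a, b] → 𝔼`: the derivative `γ' : [a, b] → V₁` (denoted `vel`)
exists and is continuous. Derivatives at the endpoints are one-sided, and the values of `toFun` and
`vel` outside `[a, b]` play no role. -/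
structure C1HCurve (a b : ℝ) where
  toFun : ℝ → Point
  vel : ℝ → horizontalLayer
  lt : a < b
  continuousOn_vel : ContinuousOn vel (Icc a b)
  hasDerivWithinAt : ∀ t ∈ Icc a b,
    HasDerivWithinAt toFun (leftField (vel t) (toFun t)) (Icc a b) t

/-- The distance on the space of `C¹` horizontal curves on `[a, b]`. -/
def C1HCurve.dist {a b : ℝ} (γ₁ γ₂ : C1HCurve a b) : ℝ≥0∞ :=
  max (⨆ t ∈ Icc a b, ccDist (γ₁.toFun t) (γ₂.toFun t))
    (⨆ t ∈ Icc a b, ‖γ₂.vel t - γ₁.vel t‖ₑ)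

/-- `𝒱` is a neighborhood of `γ` for the distance `C1HCurve.dist`. -/
def C1HCurve.IsNhd {a b : ℝ} (γ : C1HCurve a b) (𝒱 : Set (C1HCurve a b)) : Prop :=
  ∃ ε : ℝ≥0∞, 0 < ε ∧ {β : C1HCurve a b | C1HCurve.dist γ β < ε} ⊆ 𝒱

/-- Pliability of a `C¹` horizontal curve. -/
def C1HCurve.IsPliable {a b : ℝ} (γ : C1HCurve a b) : Prop :=
  ∀ 𝒱 : Set (C1HCurve a b), γ.IsNhd 𝒱 →
    {p : Point × horizontalLayer | ∃ β ∈ 𝒱,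
      (β.toFun a, β.vel a) = (γ.toFun a, γ.vel a) ∧ p = (β.toFun b, β.vel b)} ∈
      𝓝 (γ.toFun b, γ.vel b)

/-- The curve `t ↦ exp (t V)` on `[0, 1]`, for a horizontal vector `V`. -/
def expCurve (V : horizontalLayer) : C1HCurve 0 1 where
  toFun t := exp (t • (V : Alg))
  vel _ := V
  lt := zero_lt_one
  continuousOn_vel := continuousOn_const
  hasDerivWithinAt t _ := (hasDerivAt_exp_smul (V : Alg) t).hasDerivWithinAt

/-- Pliability of a horizontal vector. -/
def IsPliable (V : horizontalLayer) : Prop := (expCurve V).IsPliable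

end Engel

end

/-!
The curve from the identity with controls `u` and `v` has first coordinate `x = ∫ u` and remaining
coordinates `∫ x ^ i / i! * v` for `i = 0, 1, 2`, which are linear in `v`. If `x` is not constant,
then `1`, `x`, `x ^ 2 / 2` are linearly independent, so their Gram matrix for the weight
`t * (1 - t)` is invertible. Hence, after `u` has been adjusted to produce the right first
coordinate, adding to `v` a small combination of these three functions times the weight reaches
any nearby end point, and the weight keeps the values of `v` at both ends. The constant curve is a
limit of short loops back and forth along `X₁`, to which this applies. Small controls therefore
reach a whole neighborhood of the identity, so Euclidean closeness implies closeness for `ccDist`.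

Conversely, the fourth coordinate has derivative `x ^ 2 / 2 * v`, and near `t ↦ exp (t c X₂)` the
control `v` has the sign of `c`, so this coordinate cannot end on the other side of `0`.
-/

noncomputable section

namespace Engel

section Gram

variable {ι : Type*} [Fintype ι] {a b : ℝ} {w : ℝ → ℝ} {f : ι → ℝ → ℝ}

/-- The Gram matrix of the functions `f i` for the weight `w` on `[a, b]`. -/
def weightedGram (a b : ℝ) (w : ℝ → ℝ) (f : ι → ℝ → ℝ) : Matrix ι ι ℝ :=
  Matrix.of fun i j => ∫ t in a..b, f i t * (w t * f j t)

theorem weightedGram_mulVec (hw : Continuous w) (hf : ∀ i, Continuous (f i)) (c : ι → ℝ) (i : ι) :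
    (weightedGram a b w f).mulVec c i = ∫ t in a..b, f i t * (w t * ∑ j, c j * f j t) := by
  simp only [weightedGram, Matrix.mulVec, dotProduct, Matrix.of_apply,
    ← intervalIntegral.integral_mul_const]
  rw [← intervalIntegral.integral_finsetSum
    fun j _ => Continuous.intervalIntegrable (by fun_prop) _ _]
  simp only [Finset.mul_sum, mul_assoc, mul_comm (c _)]

theorem dotProduct_weightedGram_mulVec (hw : Continuous w) (hf : ∀ i, Continuous (f i))
    (c : ι → ℝ) :
    c ⬝ᵥ (weightedGram a b w f).mulVec c = ∫ t in a..b, w t * (∑ j, c j * f j t) ^ 2 := by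
  simp only [dotProduct, weightedGram_mulVec hw hf, ← intervalIntegral.integral_const_mul]
  rw [← intervalIntegral.integral_finsetSum
    fun j _ => Continuous.intervalIntegrable (by fun_prop) _ _]
  refine intervalIntegral.integral_congr fun t _ => ?_
  simp only [← mul_assoc, mul_right_comm _ (w t), ← Finset.sum_mul]
  ring

theorem det_weightedGram_ne_zero [DecidableEq ι] (hab : a < b) (hw : Continuous w)
    (hpos : ∀ t ∈ Ioo a b, 0 < w t) (hf : ∀ i, Continuous (f i))
    (hli : LinearIndependent ℝ fun i => (Ioo a b).domRestrict (f i)) :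
    (weightedGram a b w f).det ≠ 0 := by
  intro hdet
  obtain ⟨c, hc, hGc⟩ := Matrix.exists_mulVec_eq_zero_iff.2 hdet
  have hint : ∫ t in a..b, w t * (∑ j, c j * f j t) ^ 2 = 0 := by
    rw [← dotProduct_weightedGram_mulVec hw hf, hGc, dotProduct_zero]
  have hne : ∃ t ∈ Ioo a b, ∑ j, c j * f j t ≠ 0 := by
    by_contra! h
    refine hc (funext (Fintype.linearIndependent_iff.1 hli c ?_))
    ext t
    simpa only [Finset.sum_apply, Pi.smul_apply, Set.domRestrict_apply, smul_eq_mul,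
      Pi.zero_apply] using h t t.2
  obtain ⟨t, ht, hne⟩ := hne
  have hw_nonneg : ∀ ⦃s⦄, s ∈ Icc a b → 0 ≤ w s := by
    rw [← closure_Ioo hab.ne]
    exact le_on_closure (fun r hr => (hpos r hr).le) continuousOn_const hw.continuousOn
  have hint_pos : 0 < ∫ t in a..b, w t * (∑ j, c j * f j t) ^ 2 :=
    intervalIntegral.integral_pos hab (by fun_prop)
      (fun s hs => mul_nonneg (hw_nonneg (Ioc_subset_Icc_self hs)) (sq_nonneg _))
      ⟨t, Ioo_subset_Icc_self ht, mul_pos (hpos t ht) (sq_pos_of_ne_zero hne)⟩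
  exact hint_pos.ne' hint

end Gram

/-- The divided powers `x ^ i / i!` of a function. -/
def dividedPow {X : Type*} (x : X → ℝ) (i : ℕ) (t : X) : ℝ := x t ^ i / Nat.factorial i

theorem linearIndependent_dividedPow {X : Type*} {x : X → ℝ} (hx : (range x).Infinite) (n : ℕ) :
    LinearIndependent ℝ fun i : Fin n => dividedPow x i := by
  have hinj : Function.Injective (Polynomial.aeval (R := ℝ) x) := by
    rw [injective_iff_map_eq_zero]
    intro p hp
    refine Polynomial.eq_zero_of_infinite_isRoot p (hx.mono ?_)
    rintro _ ⟨t, rfl⟩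
    simpa [Polynomial.aeval_fn_apply] using congrFun hp t
  have hpow : LinearIndependent ℝ fun i : ℕ => x ^ i := by
    simpa [Function.comp_def] using (Polynomial.basisMonomials ℝ).linearIndependent.map'
      (Polynomial.aeval x).toLinearMap (LinearMap.ker_eq_bot.2 hinj)
  convert (hpow.comp _ (Fin.val_injective (n := n))).units_smul
    fun i => (Units.mk0 (Nat.factorial i : ℝ) (by positivity))⁻¹ using 1
  ext i t
  simp [dividedPow, Units.smul_def, div_eq_inv_mul]

theorem exists_tendsto_mulVec_eq {X ι : Type*} [TopologicalSpace X] [Fintype ι] [DecidableEq ι]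
    {M : X → Matrix ι ι ℝ} {y : X → ι → ℝ} {x₀ : X} (hM : ContinuousAt M x₀)
    (hy : ContinuousAt y x₀) (hdet : (M x₀).det ≠ 0) (hy₀ : y x₀ = 0) :
    ∃ c : X → ι → ℝ, Tendsto c (𝓝 x₀) (𝓝 0) ∧ ∀ᶠ x in 𝓝 x₀, (M x).mulVec (c x) = y x := by
  have hinv : ContinuousAt (fun x => (M x)⁻¹) x₀ :=
    ContinuousAt.comp (continuousAt_matrix_inv (M x₀) (by simpa using continuousAt_inv₀ hdet)) hM
  refine ⟨fun x => (M x)⁻¹.mulVec (y x), ?_, ?_⟩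
  · have h : Continuous fun q : Matrix ι ι ℝ × (ι → ℝ) => q.1.mulVec q.2 := by fun_prop
    simpa [hy₀, Function.comp_def] using h.continuousAt.tendsto.comp (hinv.prodMk hy)
  · have hcdet : ContinuousAt (fun x => (M x).det) x₀ := by fun_prop
    filter_upwards [hcdet.eventually_ne hdet] with x hx
    rw [Matrix.mulVec_mulVec, Matrix.mul_nonsing_inv _ hx.isUnit, Matrix.one_mulVec]

theorem eventually_forall_dist_lt {X Y Z : Type*} [TopologicalSpace X] [TopologicalSpace Y]
    [PseudoMetricSpace Z] {F : X → Y → Z} (hF : Continuous (Function.uncurry F)) (x₀ : X)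
    {K : Set Y} (hK : IsCompact K) {ε : ℝ} (hε : 0 < ε) :
    ∀ᶠ x in 𝓝 x₀, ∀ y ∈ K, dist (F x₀ y) (F x y) < ε := by
  refine hK.eventually_forall_of_forall_eventually fun y _ => ?_
  have hdist : Continuous fun q : X × Y => dist (F x₀ q.2) (F q.1 q.2) := by fun_prop
  exact hdist.continuousAt.eventually_lt_const (by simpa using hε)

/-- The primitive of `f` that vanishes at `0`. -/
def primitive (f : ℝ → ℝ) (t : ℝ) : ℝ := ∫ s in (0 : ℝ)..t, f s

@[simp]
theorem primitive_zero (f : ℝ → ℝ) : primitive f 0 = 0 := by simp [primitive]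

theorem hasDerivAt_primitive {f : ℝ → ℝ} (hf : Continuous f) (t : ℝ) :
    HasDerivAt (primitive f) (f t) t :=
  hf.integral_hasStrictDerivAt 0 t |>.hasDerivAt

theorem primitive_eq_of_hasDerivAt {f F : ℝ → ℝ} (hf : Continuous f)
    (hF : ∀ t, HasDerivAt F (f t) t) (hF₀ : F 0 = 0) : primitive f = F := by
  ext t
  rw [primitive, intervalIntegral.integral_eq_sub_of_hasDerivAt (fun s _ => hF s)
    (hf.intervalIntegrable _ _), hF₀, sub_zero]

@[fun_prop]
theorem continuous_primitive {X : Type*} [TopologicalSpace X] {f : X → ℝ → ℝ} {t : X → ℝ}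
    (hf : Continuous (Function.uncurry f)) (ht : Continuous t) :
    Continuous fun q => primitive (f q) (t q) :=
  intervalIntegral.continuous_parametric_intervalIntegral_of_continuous hf ht

/-- The moments `∫ x ^ i / i! * v` of a control, as functions of the upper limit. -/
def moment (x v : ℝ → ℝ) (i : ℕ) : ℝ → ℝ :=
  primitive fun s => dividedPow x i s * v s

/-- The coordinates of the horizontal curve from the identity with controls `u` and `v`, the
solution of `x₁' = u`, `x₂' = v`, `x₃' = x₁ v`, `x₄' = x₁² / 2 v`. -/
def lift (u v : ℝ → ℝ) (t : ℝ) : Point :=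
  !₂[primitive u t, moment (primitive u) v 0 t, moment (primitive u) v 1 t,
    moment (primitive u) v 2 t]

theorem continuous_uncurry_lift {X : Type*} [TopologicalSpace X] {u v : X → ℝ → ℝ}
    (hu : Continuous (Function.uncurry u)) (hv : Continuous (Function.uncurry v)) :
    Continuous (Function.uncurry fun q => lift (u q) (v q)) := by
  unfold lift moment dividedPow
  fun_prop

@[simp]
theorem coe_X₁ : (X₁ : Alg) = !₂[1, 0, 0, 0] := by
  ext i
  fin_cases i <;> simp [X₁, basisVec]

@[simp]
theorem coe_X₂ : (X₂ : Alg) = !₂[0, 1, 0, 0] := by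
  ext i
  fin_cases i <;> simp [X₂, basisVec]

theorem eq_smul_X₁_add_smul_X₂ (V : horizontalLayer) :
    V = (V : Alg) 0 • X₁ + (V : Alg) 1 • X₂ := by
  obtain ⟨a, b, h⟩ := Submodule.mem_span_pair.1 V.2
  obtain rfl : a • X₁ + b • X₂ = V := Subtype.ext h
  simp

theorem leftField_coe_horizontalLayer (w : horizontalLayer) (x : Point) :
    leftField w x = !₂[(w : Alg) 0, (w : Alg) 1, x 0 * (w : Alg) 1, x 0 ^ 2 / 2 * (w : Alg) 1] := by
  rw [eq_smul_X₁_add_smul_X₂ w, leftField_eq]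
  simp

theorem differentiable_mul_left (x : Point) : Differentiable ℝ (fun y : Point => x * y) :=
  ((contDiff_mul (n := 1)).comp (contDiff_const.prodMk contDiff_id)).differentiable one_ne_zero

theorem leftField_mul (v : Alg) (x y : Point) :
    leftField v (x * y) = fderiv ℝ (fun z : Point => x * z) y (leftField v y) := by
  have hcomp : (fun z : Point => x * y * z) = (fun z => x * z) ∘ fun z => y * z :=
    funext fun z => mul_assoc x y z
  rw [leftField, hcomp, fderiv_comp _ (differentiable_mul_left x _) (differentiable_mul_left y _),
    mul_one]
  rfl

namespace C1HCurve

variable {a b : ℝ}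

/-- The `1`-jet `(γ t, γ' t)`. -/
def jet (γ : C1HCurve a b) (t : ℝ) : Point × horizontalLayer := (γ.toFun t, γ.vel t)

theorem continuousOn_toFun (γ : C1HCurve a b) : ContinuousOn γ.toFun (Icc a b) :=
  fun t ht => (γ.hasDerivWithinAt t ht).continuousWithinAt

theorem absolutelyContinuousOnInterval (γ : C1HCurve a b) :
    AbsolutelyContinuousOnInterval γ.toFun a b := by
  have hcont : ContinuousOn (fun t => leftField (γ.vel t) (γ.toFun t)) (Icc a b) := by
    have := γ.continuousOn_toFun
    have := γ.continuousOn_vel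
    simp only [leftField_eq]
    fun_prop
  obtain ⟨C, hC⟩ := isCompact_Icc.exists_bound_of_continuousOn hcont
  have hlip : LipschitzOnWith C.toNNReal γ.toFun (uIcc a b) := by
    rw [uIcc_of_le γ.lt.le]
    exact (convex_Icc a b).lipschitzOnWith_of_nnnorm_hasDerivWithin_le γ.hasDerivWithinAt
      fun t ht => by
        rw [← NNReal.coe_le_coe, coe_nnnorm]
        exact (hC t ht).trans (Real.le_coe_toNNReal C)
  exact hlip.absolutelyContinuousOnInterval

theorem isHorizontalCurve (γ : C1HCurve a b) : IsHorizontalCurve a b γ.toFun γ.vel where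
  le := γ.lt.le
  absolutelyContinuous := γ.absolutelyContinuousOnInterval
  integrable := γ.continuousOn_vel.integrableOn_Icc
  hasDerivAt := by
    rw [← restrict_Ioo_eq_restrict_Icc]
    filter_upwards [ae_restrict_mem measurableSet_Ioo] with t ht
    exact (γ.hasDerivWithinAt t (Ioo_subset_Icc_self ht)).hasDerivAt (Icc_mem_nhds ht.1 ht.2)

theorem ccDist_le_lintegral (γ : C1HCurve a b) :
    ccDist (γ.toFun a) (γ.toFun b) ≤ ∫⁻ t in Icc a b, ‖γ.vel t‖ₑ :=
  sInf_le ⟨a, b, γ.toFun, γ.vel, γ.isHorizontalCurve, rfl, rfl, rfl⟩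

/-- The left translate of a curve by `x`. -/
def mulLeft (x : Point) (γ : C1HCurve a b) : C1HCurve a b where
  toFun t := x * γ.toFun t
  vel := γ.vel
  lt := γ.lt
  continuousOn_vel := γ.continuousOn_vel
  hasDerivWithinAt t ht := by
    rw [leftField_mul]
    exact (differentiable_mul_left x _).hasFDerivAt.comp_hasDerivWithinAt t
      (γ.hasDerivWithinAt t ht)

/-- Pliability for the uniform distance of `1`-jets, with `ccDist` replaced by the Euclidean
distance of the coordinates. -/
def IsUniformlyPliable (γ : C1HCurve a b) : Prop :=
  ∀ ε > 0, ∀ᶠ p in 𝓝 (γ.jet b), ∃ β : C1HCurve a b,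
    β.jet a = γ.jet a ∧ β.jet b = p ∧ ∀ t ∈ Icc a b, Dist.dist (γ.jet t) (β.jet t) < ε

theorem isUniformlyPliable_of_forall_exists {γ : C1HCurve a b}
    (h : ∀ ε > 0, ∃ γ' : C1HCurve a b, γ'.IsUniformlyPliable ∧ γ'.jet a = γ.jet a ∧
      γ'.jet b = γ.jet b ∧ ∀ t ∈ Icc a b, Dist.dist (γ.jet t) (γ'.jet t) < ε) :
    γ.IsUniformlyPliable := by
  intro ε hε
  obtain ⟨γ', hγ', ha, hb, hdist⟩ := h (ε / 2) (half_pos hε)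
  filter_upwards [hb ▸ hγ' (ε / 2) (half_pos hε)] with p ⟨β, hβa, hβb, hβ⟩
  refine ⟨β, hβa.trans ha, hβb, fun t ht => ?_⟩
  linarith [dist_triangle (γ.jet t) (γ'.jet t) (β.jet t), hdist t ht, hβ t ht]

end C1HCurve

theorem lift_apply_zero (u v : ℝ → ℝ) : lift u v 0 = 1 := by
  ext i
  fin_cases i <;> simp [lift, moment, one_def]

theorem hasDerivAt_lift {u v : ℝ → ℝ} (hu : Continuous u) (hv : Continuous v) (t : ℝ) :
    HasDerivAt (lift u v) (leftField (u t • X₁ + v t • X₂ : horizontalLayer) (lift u v t)) t := by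
  have hmoment : ∀ i,
      HasDerivAt (moment (primitive u) v i) (dividedPow (primitive u) i t * v t) t :=
    fun i => hasDerivAt_primitive (by unfold dividedPow; fun_prop) t
  refine (hasDerivAt_toLp (hasDerivAt_primitive hu t) (hmoment 0) (hmoment 1)
    (hmoment 2)).congr_deriv ?_
  rw [leftField_coe_horizontalLayer]
  simp [lift, dividedPow]

/-- The element `lift u v` of the space of `C¹` horizontal curves on `[0, 1]`. -/
def ofControls (u v : ℝ → ℝ) (hu : Continuous u) (hv : Continuous v) : C1HCurve 0 1 where
  toFun := lift u v
  vel t := u t • X₁ + v t • X₂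
  lt := zero_lt_one
  continuousOn_vel := by fun_prop
  hasDerivWithinAt t _ := (hasDerivAt_lift hu hv t).hasDerivWithinAt

theorem continuous_uncurry_ofControls_jet {X : Type*} [TopologicalSpace X] {u v : X → ℝ → ℝ}
    (hu : Continuous (Function.uncurry u)) (hv : Continuous (Function.uncurry v)) :
    Continuous (Function.uncurry fun q =>
      (ofControls (u q) (v q) (by fun_prop) (by fun_prop)).jet) := by
  unfold C1HCurve.jet ofControls
  have := continuous_uncurry_lift hu hv
  fun_prop

/-- The perturbation of `f` on `[0, 1]` with value `e` at `1`, unchanged value at `0`, and `g` as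
free parameter in between. -/
def adjust (f : ℝ → ℝ) (e : ℝ) (g : ℝ → ℝ) (t : ℝ) : ℝ :=
  f t + (e - f 1) * t + t * (1 - t) * g t

@[simp]
theorem adjust_apply_zero (f g : ℝ → ℝ) (e : ℝ) : adjust f e g 0 = f 0 := by simp [adjust]

@[simp]
theorem adjust_apply_one (f g : ℝ → ℝ) (e : ℝ) : adjust f e g 1 = e := by simp [adjust]

@[fun_prop]
theorem continuous_adjust {X : Type*} [TopologicalSpace X] {f : ℝ → ℝ} {e : X → ℝ}
    {g : X → ℝ → ℝ} {t : X → ℝ} (hf : Continuous f) (he : Continuous e)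
    (hg : Continuous (Function.uncurry g)) (ht : Continuous t) :
    Continuous fun q => adjust f (e q) (g q) (t q) := by
  unfold adjust
  fun_prop

/-- The control near `u` whose value at `1` and whose integral over `[0, 1]` are those prescribed by
the `1`-jet `p`; in the formula, `1 / 2` is `∫ t` and `6` is the inverse of `∫ t (1 - t)`. -/
def steerFst (u : ℝ → ℝ) (p : Point × horizontalLayer) : ℝ → ℝ :=
  adjust u ((p.2 : Alg) 0)
    fun _ => 6 * (p.1 0 - primitive u 1 - ((p.2 : Alg) 0 - u 1) / 2)

theorem primitive_steerFst_one {u : ℝ → ℝ} (hu : Continuous u) (p : Point × horizontalLayer) :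
    primitive (steerFst u p) 1 = p.1 0 := by
  set e : ℝ := (p.2 : Alg) 0
  set k : ℝ := 6 * (p.1 0 - primitive u 1 - (e - u 1) / 2) with hk
  have hcont : Continuous (steerFst u p) := by unfold steerFst; fun_prop
  have hderiv : ∀ t, HasDerivAt
      (fun t => primitive u t + (e - u 1) * (t ^ 2 / 2) + k * (t ^ 2 / 2 - t ^ 3 / 3))
      (steerFst u p t) t := fun t => by
    have h2 : HasDerivAt (fun t : ℝ => t ^ 2 / 2) t t := by
      simpa using (hasDerivAt_pow 2 t).div_const 2
    have h3 : HasDerivAt (fun t : ℝ => t ^ 3 / 3) (t ^ 2) t := by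
      simpa using (hasDerivAt_pow 3 t).div_const 3
    refine (((hasDerivAt_primitive hu t).add (h2.const_mul _)).add
      ((h2.sub h3).const_mul k)).congr_deriv ?_
    simp only [steerFst, adjust]
    ring
  rw [primitive_eq_of_hasDerivAt hcont hderiv (by simp), hk]
  ring

/-- The perturbation of the control `v` with value prescribed by the `1`-jet `p` at `1`, in the
directions of the divided powers of the first coordinate of the steered curve. -/
def steerSnd (u v : ℝ → ℝ) (p : Point × horizontalLayer) (c : Fin 3 → ℝ) : ℝ → ℝ :=
  adjust v ((p.2 : Alg) 1) fun t => ∑ j, c j * dividedPow (primitive (steerFst u p)) j t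

/-- The derivative of the moments of `steerSnd u v p c` with respect to `c`. -/
def steerGram (u : ℝ → ℝ) (p : Point × horizontalLayer) : Matrix (Fin 3) (Fin 3) ℝ :=
  weightedGram 0 1 (fun t => t * (1 - t)) fun i => dividedPow (primitive (steerFst u p)) i

@[fun_prop]
theorem continuous_steerFst {X : Type*} [TopologicalSpace X] {u : ℝ → ℝ}
    {p : X → Point × horizontalLayer} {t : X → ℝ} (hu : Continuous u) (hp : Continuous p)
    (ht : Continuous t) : Continuous fun q => steerFst u (p q) (t q) := by
  unfold steerFst
  fun_prop

@[fun_prop]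
theorem continuous_steerSnd {X : Type*} [TopologicalSpace X] {u v : ℝ → ℝ}
    {p : X → Point × horizontalLayer} {c : X → Fin 3 → ℝ} {t : X → ℝ} (hu : Continuous u)
    (hv : Continuous v) (hp : Continuous p) (hc : Continuous c) (ht : Continuous t) :
    Continuous fun q => steerSnd u v (p q) (c q) (t q) := by
  unfold steerSnd dividedPow
  fun_prop

theorem moment_steerSnd {u v : ℝ → ℝ} (hu : Continuous u) (hv : Continuous v)
    (p : Point × horizontalLayer) (c : Fin 3 → ℝ) (i : Fin 3) :
    moment (primitive (steerFst u p)) (steerSnd u v p c) i 1 =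
      moment (primitive (steerFst u p)) (steerSnd u v p 0) i 1 + (steerGram u p).mulVec c i := by
  set x := primitive (steerFst u p)
  have hx : ∀ i, Continuous (dividedPow x i) := by
    unfold x dividedPow
    fun_prop
  rw [steerGram, weightedGram_mulVec (by fun_prop) fun j : Fin 3 => hx j, moment, moment, primitive,
    primitive, ← intervalIntegral.integral_add]
  · refine intervalIntegral.integral_congr fun t _ => ?_
    simp only [steerSnd, adjust, Pi.zero_apply, zero_mul, Finset.sum_const_zero]
    ring
  all_goals exact Continuous.intervalIntegrable (by fun_prop) _ _

section Steering

variable {u v : ℝ → ℝ}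

/-- The part of the endpoint condition `p` that the moments still miss for `c = 0` in
`steerSnd u v p c`. -/
def steerResidual (u v : ℝ → ℝ) (p : Point × horizontalLayer) (i : Fin 3) : ℝ :=
  p.1 i.succ - moment (primitive (steerFst u p)) (steerSnd u v p 0) i 1

/-- The curve with controls `steerFst u p` and `steerSnd u v p c`. -/
def steer (u v : ℝ → ℝ) (hu : Continuous u) (hv : Continuous v) (p : Point × horizontalLayer)
    (c : Fin 3 → ℝ) : C1HCurve 0 1 :=
  ofControls (steerFst u p) (steerSnd u v p c) (by fun_prop) (by fun_prop)

theorem steer_jet_zero (hu : Continuous u) (hv : Continuous v) (p : Point × horizontalLayer)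
    (c : Fin 3 → ℝ) : (steer u v hu hv p c).jet 0 = (ofControls u v hu hv).jet 0 := by
  simp [C1HCurve.jet, steer, ofControls, lift_apply_zero, steerFst, steerSnd]

theorem steer_jet_one (hu : Continuous u) (hv : Continuous v) {p : Point × horizontalLayer}
    {c : Fin 3 → ℝ} (hc : (steerGram u p).mulVec c = steerResidual u v p) :
    (steer u v hu hv p c).jet 1 = p := by
  have hmoment : ∀ i : Fin 3,
      moment (primitive (steerFst u p)) (steerSnd u v p c) i 1 = p.1 i.succ := fun i => by
    rw [moment_steerSnd hu hv, hc, steerResidual, add_sub_cancel]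
  refine Prod.ext ?_ ?_
  · ext i
    fin_cases i
    exacts [primitive_steerFst_one hu p, hmoment 0, hmoment 1, hmoment 2]
  · conv_rhs => rw [eq_smul_X₁_add_smul_X₂ p.2]
    simp [C1HCurve.jet, steer, ofControls, steerFst, steerSnd]

theorem steerFst_jet_one (hu : Continuous u) (hv : Continuous v) :
    steerFst u ((ofControls u v hu hv).jet 1) = u := by
  ext t
  simp [steerFst, adjust, C1HCurve.jet, ofControls, lift]

theorem steerSnd_jet_one (hu : Continuous u) (hv : Continuous v) :
    steerSnd u v ((ofControls u v hu hv).jet 1) 0 = v := by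
  ext t
  simp [steerSnd, adjust, C1HCurve.jet, ofControls]

theorem steer_jet_one_zero (hu : Continuous u) (hv : Continuous v) :
    steer u v hu hv ((ofControls u v hu hv).jet 1) 0 = ofControls u v hu hv := by
  simp only [steer, steerFst_jet_one, steerSnd_jet_one]

theorem steerResidual_jet_one (hu : Continuous u) (hv : Continuous v) :
    steerResidual u v ((ofControls u v hu hv).jet 1) = 0 := by
  ext i
  rw [steerResidual, steerFst_jet_one, steerSnd_jet_one]
  fin_cases i <;> simp [C1HCurve.jet, ofControls, lift]

theorem continuous_steerGram (hu : Continuous u) : Continuous (steerGram u) := by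
  unfold steerGram weightedGram dividedPow
  refine continuous_matrix fun i j => ?_
  exact intervalIntegral.continuous_parametric_intervalIntegral_of_continuous' (by fun_prop) 0 1

theorem continuous_steerResidual (hu : Continuous u) (hv : Continuous v) :
    Continuous (steerResidual u v) := by
  unfold steerResidual moment dividedPow
  refine continuous_pi fun i => ?_
  fun_prop

theorem infinite_image_primitive {a b : ℝ} (hu : Continuous u) (h : ∃ t ∈ Ioo a b, u t ≠ 0) :
    (primitive u '' Ioo a b).Infinite := by
  obtain ⟨t, ht, hut⟩ := h
  have hne : ∀ᶠ s in 𝓝[≠] t, primitive u s ≠ primitive u t :=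
    (hasDerivAt_primitive hu t).eventually_ne hut
  obtain ⟨s, hs, hsab⟩ := (hne.and (nhdsWithin_le_nhds (Ioo_mem_nhds ht.1 ht.2))).exists
  exact (isPreconnected_Ioo.image _ (by fun_prop)).infinite_of_nontrivial
    ⟨_, mem_image_of_mem _ hsab, _, mem_image_of_mem _ ht, hs⟩

theorem det_steerGram_jet_one_ne_zero (hu : Continuous u) (hv : Continuous v)
    (h : ∃ t ∈ Ioo (0 : ℝ) 1, u t ≠ 0) :
    (steerGram u ((ofControls u v hu hv).jet 1)).det ≠ 0 := by
  rw [steerGram, steerFst_jet_one]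
  refine det_weightedGram_ne_zero one_pos (by fun_prop)
    (fun t ht => mul_pos ht.1 (sub_pos.2 ht.2)) (fun i => by unfold dividedPow; fun_prop) ?_
  refine linearIndependent_dividedPow (x := (Ioo 0 1).domRestrict (primitive u)) ?_ 3
  rw [range_domRestrict]
  exact infinite_image_primitive hu h

theorem continuous_uncurry_steer_jet (hu : Continuous u) (hv : Continuous v) :
    Continuous (Function.uncurry fun q : (Point × horizontalLayer) × (Fin 3 → ℝ) =>
      (steer u v hu hv q.1 q.2).jet) := by
  unfold steer
  refine continuous_uncurry_ofControls_jet ?_ ?_ <;> fun_prop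

theorem isUniformlyPliable_ofControls (hu : Continuous u) (hv : Continuous v)
    (h : ∃ t ∈ Ioo (0 : ℝ) 1, u t ≠ 0) : (ofControls u v hu hv).IsUniformlyPliable := by
  intro ε hε
  obtain ⟨c, hc, hsolve⟩ := exists_tendsto_mulVec_eq (continuous_steerGram hu).continuousAt
    (continuous_steerResidual hu hv).continuousAt (det_steerGram_jet_one_ne_zero hu hv h)
    (steerResidual_jet_one hu hv)
  have hclose := (tendsto_id.prodMk_nhds hc).eventually
    (eventually_forall_dist_lt (continuous_uncurry_steer_jet hu hv) (_, 0)
      (isCompact_Icc (a := (0 : ℝ)) (b := 1)) hε)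
  filter_upwards [hsolve, hclose] with p hp hdist
  refine ⟨steer u v hu hv p (c p), steer_jet_zero hu hv p _, steer_jet_one hu hv hp, ?_⟩
  simpa only [steer_jet_one_zero, id] using hdist

end Steering

theorem ofControls_const (a b : ℝ) :
    ofControls (fun _ => a) (fun _ => b) continuous_const continuous_const =
      expCurve (a • X₁ + b • X₂) := by
  have hlift : lift (fun _ => a) (fun _ => b) =
      fun t => exp (t • ((a • X₁ + b • X₂ : horizontalLayer) : Alg)) := by
    ext t i
    fin_cases i <;>
      simp [lift, moment, primitive, dividedPow, exp, mul_pow, integral_pow] <;> ring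
  simp only [ofControls, expCurve, hlift]

theorem isUniformlyPliable_expCurve_of_ne_zero {a : ℝ} (ha : a ≠ 0) (b : ℝ) :
    (expCurve (a • X₁ + b • X₂)).IsUniformlyPliable := by
  rw [← ofControls_const]
  exact isUniformlyPliable_ofControls _ _ ⟨1 / 2, by norm_num, ha⟩

/-- Controls of short closed curves, back and forth along `X₁`, whose `1`-jets at the ends are
zero. -/
def loopControl (η t : ℝ) : ℝ := η * (t * (1 - t) * (1 - 2 * t))

@[fun_prop]
theorem continuous_uncurry_loopControl : Continuous (Function.uncurry loopControl) := by
  unfold loopControl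
  fun_prop

theorem primitive_loopControl (η : ℝ) :
    primitive (loopControl η) = fun t => η * ((t * (1 - t)) ^ 2 / 2) := by
  refine primitive_eq_of_hasDerivAt (by fun_prop) (fun t => ?_) (by simp)
  have h : HasDerivAt (fun s : ℝ => s * (1 - s)) (1 - 2 * t) t :=
    ((hasDerivAt_id t).mul ((hasDerivAt_id t).const_sub 1)).congr_deriv (by simp; ring)
  refine (((h.pow 2).div_const 2).const_mul η).congr_deriv ?_
  simp only [loopControl, Nat.cast_ofNat]
  ring

theorem isUniformlyPliable_expCurve_zero : (expCurve 0).IsUniformlyPliable := by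
  let γ : ℝ → C1HCurve 0 1 := fun η =>
    ofControls (loopControl η) (fun _ => 0) (by fun_prop) continuous_const
  have hγ₀ : γ 0 = expCurve 0 := by
    have hloop : loopControl 0 = fun _ => 0 := by ext; simp [loopControl]
    simpa [γ, hloop] using ofControls_const 0 0
  have hstart : ∀ η, (γ η).jet 0 = (1, 0) := fun η => by
    simp [C1HCurve.jet, γ, ofControls, lift_apply_zero, loopControl]
  have hend : ∀ η, (γ η).jet 1 = (1, 0) := fun η => by
    have hprimitive : primitive (loopControl η) 1 = 0 := by simp [primitive_loopControl]
    have hzero : primitive (fun _ => 0) 1 = 0 := by simp [primitive]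
    refine Prod.ext ?_ (by simp [C1HCurve.jet, γ, ofControls, loopControl])
    ext i
    fin_cases i <;> simp [C1HCurve.jet, γ, ofControls, lift, moment, hprimitive, hzero, one_def]
  refine C1HCurve.isUniformlyPliable_of_forall_exists fun ε hε => ?_
  have hcont : Continuous (Function.uncurry fun η => (γ η).jet) := by
    refine continuous_uncurry_ofControls_jet ?_ ?_ <;> fun_prop
  have hclose := eventually_forall_dist_lt hcont 0 (isCompact_Icc (a := 0) (b := 1)) hε
  obtain ⟨η, hη, hclose⟩ := (eventually_mem_nhdsWithin.and
    (hclose.filter_mono (nhdsWithin_le_nhds (s := {0}ᶜ)))).exists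
  refine ⟨γ η, isUniformlyPliable_ofControls _ _ ⟨1 / 4, by norm_num, ?_⟩, ?_, ?_, ?_⟩
  · exact mul_ne_zero hη (by norm_num)
  · rw [← hγ₀, hstart, hstart]
  · rw [← hγ₀, hend, hend]
  · rwa [← hγ₀]

theorem eventually_forall_ccDist_mul_le {ε : ℝ} (hε : 0 < ε) :
    ∀ᶠ z : Point in 𝓝 1, ∀ x, ccDist x (x * z) ≤ ENNReal.ofReal ε := by
  have hjet : ∀ t, (expCurve 0).jet t = (1, 0) := fun t => by
    simp [C1HCurve.jet, expCurve, exp_zero]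
  have hcont : Tendsto (fun z : Point => (z, (0 : horizontalLayer))) (𝓝 1)
      (𝓝 ((expCurve 0).jet 1)) := by
    rw [hjet]
    exact (Continuous.prodMk_left _).tendsto 1
  filter_upwards [hcont.eventually (isUniformlyPliable_expCurve_zero ε hε)]
    with z ⟨β, hβ0, hβ1, hβ⟩ x
  have hvel : ∀ t ∈ Icc (0 : ℝ) 1, ‖β.vel t‖ₑ ≤ ENNReal.ofReal ε := fun t ht => by
    have hlt := (le_max_right _ _).trans_lt (hβ t ht)
    rw [hjet] at hlt
    simpa [C1HCurve.jet, ← ofReal_norm] using ENNReal.ofReal_le_ofReal hlt.le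
  calc ccDist x (x * z) = ccDist ((β.mulLeft x).toFun 0) ((β.mulLeft x).toFun 1) := by
        have h0 : β.toFun 0 = 1 := congrArg Prod.fst (hβ0.trans (hjet 0))
        have h1 : β.toFun 1 = z := congrArg Prod.fst hβ1
        simp only [C1HCurve.mulLeft, h0, h1, mul_one]
    _ ≤ ∫⁻ t in Icc (0 : ℝ) 1, ‖β.vel t‖ₑ := (β.mulLeft x).ccDist_le_lintegral
    _ ≤ ∫⁻ _ in Icc (0 : ℝ) 1, ENNReal.ofReal ε := setLIntegral_mono measurable_const hvel
    _ = ENNReal.ofReal ε := by simp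

theorem exists_forall_dist_lt_ccDist_le {K : Set Point} (hK : IsCompact K) {ε : ℝ} (hε : 0 < ε) :
    ∃ δ > 0, ∀ x ∈ K, ∀ y, dist x y < δ → ccDist x y ≤ ENNReal.ofReal ε := by
  have hcont : Continuous fun q : Point × Point => q.2⁻¹ * (q.2 + q.1) :=
    (contDiff_mul (n := 0)).continuous.comp
      (((contDiff_inv (n := 0)).continuous.comp continuous_snd).prodMk
        (continuous_snd.add continuous_fst))
  have hnear : ∀ᶠ z : Point in 𝓝 0, ∀ x ∈ K, ccDist x (x + z) ≤ ENNReal.ofReal ε := by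
    refine hK.eventually_forall_of_forall_eventually fun x _ => ?_
    have htend : Tendsto (fun q : Point × Point => q.2⁻¹ * (q.2 + q.1)) (𝓝 (0, x)) (𝓝 1) := by
      simpa using hcont.tendsto (0, x)
    filter_upwards [htend.eventually (eventually_forall_ccDist_mul_le hε)] with q hq
    simpa using hq q.2
  obtain ⟨δ, hδ, hball⟩ := Metric.eventually_nhds_iff.1 hnear
  refine ⟨δ, hδ, fun x hx y hxy => ?_⟩
  simpa using hball (y := y - x) (by simpa [dist_eq_norm, norm_sub_rev] using hxy) x hx

theorem C1HCurve.IsUniformlyPliable.isPliable {a b : ℝ} {γ : C1HCurve a b}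
    (hγ : γ.IsUniformlyPliable) : γ.IsPliable := by
  rintro 𝒱 ⟨ε', hε', h𝒱⟩
  obtain ⟨ε, -, hε, hεε'⟩ := ENNReal.lt_iff_exists_real_btwn.1 hε'
  rw [ENNReal.ofReal_pos] at hε
  obtain ⟨δ, hδ, hcc⟩ :=
    exists_forall_dist_lt_ccDist_le (isCompact_Icc.image_of_continuousOn γ.continuousOn_toFun) hε
  filter_upwards [hγ (min ε δ) (lt_min hε hδ)] with p ⟨β, hβa, hβb, hβ⟩
  have hdist : C1HCurve.dist γ β ≤ ENNReal.ofReal ε := by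
    refine max_le (iSup₂_le fun t ht => ?_) (iSup₂_le fun t ht => ?_)
    · exact hcc _ (mem_image_of_mem _ ht) _
        ((le_max_left _ _).trans_lt ((hβ t ht).trans_le (min_le_right _ _)))
    · have hvel := (le_max_right _ _).trans_lt ((hβ t ht).trans_le (min_le_left _ _))
      rw [dist_comm, dist_eq_norm] at hvel
      rw [← ofReal_norm]
      exact ENNReal.ofReal_le_ofReal hvel.le
  exact ⟨β, h𝒱 (hdist.trans_lt hεε'), hβa, hβb.symm⟩

theorem nonneg_mul_vel_of_enorm_sub_lt {w : horizontalLayer} {c : ℝ}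
    (h : ‖w - c • X₂‖ₑ < ‖c‖ₑ) : 0 ≤ c * (w : Alg) 1 := by
  have hcoord : |(w : Alg) 1 - c| < |c| := by
    rw [← ofReal_norm, ← ofReal_norm, ENNReal.ofReal_lt_ofReal_iff'] at h
    refine lt_of_le_of_lt ?_ h.1
    simpa using PiLp.norm_apply_le ((w - c • X₂ : horizontalLayer) : Alg) 1
  nlinarith [sq_lt_sq.2 hcoord, sq_nonneg ((w : Alg) 1)]

theorem monotoneOn_mul_toFun_three {a b c : ℝ} (β : C1HCurve a b)
    (h : ∀ t ∈ Icc a b, 0 ≤ c * (β.vel t : Alg) 1) :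
    MonotoneOn (fun t => c * β.toFun t 3) (Icc a b) := by
  have hder : ∀ t ∈ Icc a b, HasDerivWithinAt (fun t => c * β.toFun t 3)
      (c * leftField (β.vel t) (β.toFun t) 3) (Icc a b) t := fun t ht =>
    ((EuclideanSpace.proj (𝕜 := ℝ) (3 : Fin 4)).hasFDerivAt.comp_hasDerivWithinAt t
      (β.hasDerivWithinAt t ht)).const_mul c
  refine monotoneOn_of_hasDerivWithinAt_nonneg (convex_Icc a b)
    (fun t ht => (hder t ht).continuousWithinAt)
    (fun t ht => (hder t (interior_subset ht)).mono interior_subset) fun t ht => ?_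
  rw [leftField_coe_horizontalLayer]
  calc 0 ≤ β.toFun t 0 ^ 2 / 2 * (c * (β.vel t : Alg) 1) :=
        mul_nonneg (by positivity) (h t (interior_subset ht))
    _ = c * (β.toFun t 0 ^ 2 / 2 * (β.vel t : Alg) 1) := by ring

theorem not_isPliable_smul_X₂ {c : ℝ} (hc : c ≠ 0) : ¬ IsPliable (c • X₂) := by
  intro hp
  have hnhds := hp {β | C1HCurve.dist (expCurve (c • X₂)) β < ‖c‖ₑ}
    ⟨‖c‖ₑ, by simpa using hc, subset_rfl⟩
  let p : ℝ → Point × horizontalLayer := fun δ => (!₂[0, c, 0, -(c * δ)], c • X₂)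
  have hp₀ : p 0 = ((expCurve (c • X₂)).toFun 1, (expCurve (c • X₂)).vel 1) := by
    refine Prod.ext ?_ rfl
    ext i
    fin_cases i <;> simp [p, expCurve, exp]
  have hcont : Tendsto p (𝓝 0) (𝓝 (p 0)) :=
    Continuous.tendsto (by fun_prop) 0
  rw [hp₀] at hcont
  obtain ⟨δ, hδ, β, hβ, hβ0, hβ1⟩ := (eventually_mem_nhdsWithin.and
    ((hcont.eventually hnhds).filter_mono (nhdsWithin_le_nhds (s := Ioi 0)))).exists
  have hvel : ∀ t ∈ Icc (0 : ℝ) 1, 0 ≤ c * (β.vel t : Alg) 1 := fun t ht =>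
    nonneg_mul_vel_of_enorm_sub_lt <|
      ((le_iSup₂ (f := fun t (_ : t ∈ Icc (0 : ℝ) 1) => ‖β.vel t - c • X₂‖ₑ) t ht).trans
        (le_max_right _ _)).trans_lt hβ
  have hle := monotoneOn_mul_toFun_three β hvel (left_mem_Icc.2 zero_le_one)
    (right_mem_Icc.2 zero_le_one) zero_le_one
  have h0 : β.toFun 0 3 = 0 := by
    simpa [expCurve, exp] using congrArg (fun q => q.1 3) hβ0
  have h1 : β.toFun 1 3 = -(c * δ) := congrArg (fun q => q.1 3) hβ1.symm
  have hpos : 0 < c ^ 2 * δ := mul_pos (by positivity) hδ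
  simp only [h0, h1] at hle
  linarith

theorem isPliable_smul_X₁_add_smul_X₂_iff {a b : ℝ} :
    IsPliable (a • X₁ + b • X₂) ↔ a ≠ 0 ∨ (a = 0 ∧ b = 0) := by
  refine ⟨fun h => ?_, ?_⟩
  · by_contra! hab
    obtain ⟨rfl, hb⟩ := hab
    exact not_isPliable_smul_X₂ (hb rfl) (by simpa using h)
  · rintro (ha | ⟨rfl, rfl⟩)
    · exact (isUniformlyPliable_expCurve_of_ne_zero ha b).isPliable
    · rw [zero_smul, zero_smul, zero_add]
      exact isUniformlyPliable_expCurve_zero.isPliable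

end Engel

end

theorem theorem4p1 :
    (∀ a b : ℝ, Engel.IsPliable (a • Engel.X₁ + b • Engel.X₂) ↔ (a ≠ 0 ∨ (a = 0 ∧ b = 0))) ∧
    (∀ V : Engel.horizontalLayer,
      ¬ Engel.IsPliable V ↔ ∃ c : ℝ, c ≠ 0 ∧ V = c • Engel.X₂) := by
  refine ⟨fun a b => Engel.isPliable_smul_X₁_add_smul_X₂_iff, fun V => ⟨fun h => ?_, ?_⟩⟩
  · have hV := Engel.eq_smul_X₁_add_smul_X₂ V
    rw [hV, Engel.isPliable_smul_X₁_add_smul_X₂_iff] at h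
    push Not at h
    exact ⟨(V : Engel.Alg) 1, h.2 h.1, by simpa [h.1] using hV⟩
  · rintro ⟨c, hc, rfl⟩
    exact Engel.not_isPliable_smul_X₂ hc
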